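/- All graphs are finite, simple and undirected; the eigenvalues of a graph and their multiplicities are those of its real symmetric adjacency matrix. For a vertex $v$ let $N(v)$ be its open neighborhood and $N[v]=N(v)\cup\{v\}$ its closed neighborhood. A cograph is a graph with no induced path on four vertices. The vicinal preorder on the vertex set $V(G)$ of a graph $G$ is defined by $u\prec v$ if and only if $N(u)\subseteq N[v]$. A chain is a set of vertices any two of which are comparable under $\prec$, and the Dilworth number $\nabla(G)$ is the minimum number of chains needed to cover $V(G)$. Theorem. (i) Let $G$ be a cograph and let $\lambda\notin\{0,-1\}$ be an eigenvalue of $G$. Then the multiplicity of $\lambda$ as an eigenvalue of $G$ is at most $\nabla(G)$. (ii) There are infinitely many connected cographs for which this bound is attained. For integers $s,k\ge 1$ let $$G(s,k)=K_1\vee\bigl(K_{s,\ldots,s}\cup (s^2-s)K_1\bigr),$$ where $K_{s,\ldots,s}$ is the complete $k$-partite graph with all parts of size $s$, $\cup$ denotes disjoint union, and $\vee$ denotes the join of graphs. Then $G(s,k)$ is a connected cograph and $-s$ is an eigenvalue of $G(s,k)$ of multiplicity exactly $k$. If $s\ge 2$ (so that $-s\notin\{0,-1\}$), then moreover $\nabla(G(s,k))=k$,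 so that the bound in (i) is attained by $\lambda=-s$. The graphs $G(s,k)$ with $s\ge2$, $k\ge1$ are pairwise non-isomorphic for distinct pairs $(s,k)$. -/

import Mathlib

/-- A cograph: a simple graph with no induced path on four vertices. -/
def IsCograph {V : Type*} (G : SimpleGraph V) : Prop :=
  ¬ (SimpleGraph.pathGraph 4).IsIndContained G

/-- The vicinal preorder of a graph: `u ≺ v` iff the open neighbourhood of `u` is contained in the
closed neighbourhood of `v`. -/
def Vicinal {V : Type*} (G : SimpleGraph V) (u v : V) : Prop :=
  G.neighborSet u ⊆ insert v (G.neighborSet v)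

/-- The Dilworth number of a finite graph: the least `n` such that `n` chains of the vicinal
preorder cover the vertex set. -/
noncomputable def dilworthNumber {V : Type*} [Fintype V] (G : SimpleGraph V) : ℕ :=
  sInf {n : ℕ | ∃ C : Fin n → Set V,
    (∀ i, IsChain (Vicinal G) (C i)) ∧ ⋃ i, C i = Set.univ}

open Classical in
/-- The adjacency matrix of a finite graph over `ℝ`, as a linear operator on `V → ℝ`. -/
noncomputable def adjOperator {V : Type*} [Fintype V] (G : SimpleGraph V) :
    Module.End ℝ (V → ℝ) :=
  Matrix.toLin' (G.adjMatrix ℝ)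

/-- The multiplicity of `μ` as an eigenvalue of (the adjacency matrix of) `G`, i.e. the dimension
of the eigenspace; the matrix is real symmetric, so this is also the algebraic multiplicity. -/
noncomputable def eigMult {V : Type*} [Fintype V] (G : SimpleGraph V) (μ : ℝ) : ℕ :=
  Module.finrank ℝ (Module.End.eigenspace (adjOperator G) μ)

/-- The join `G ∨ H`: the disjoint union together with all edges between the two graphs. -/
def graphJoin {V W : Type*} (G : SimpleGraph V) (H : SimpleGraph W) : SimpleGraph (V ⊕ W) :=
  (G.sum H) ⊔ completeBipartiteGraph V W

/-- The graph `K_1 ∨ (K_{s,…,s} ∪ (s² - s) K_1)`, where `K_{s,…,s}` is the complete `k`-partite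
graph with parts of size `s` and `∪` is the disjoint union. -/
def extremalCograph (s k : ℕ) :
    SimpleGraph (Fin 1 ⊕ ((Fin k × Fin s) ⊕ Fin (s ^ 2 - s))) :=
  graphJoin (⊥ : SimpleGraph (Fin 1))
    ((SimpleGraph.completeEquipartiteGraph k s).sum (⊥ : SimpleGraph (Fin (s ^ 2 - s))))

/-! For the bound, let `x` be supported on `S` and satisfy `A x = μ x + c` on `S` for an arbitrary
constant `c`. Such vectors form a space containing the `μ`-eigenspace when `S` is everything. Since
the complement has adjacency matrix `J - I - A` and `J x` is constant, the relaxed condition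
survives complementation with `μ` replaced by `-1 - μ`; this exchanges the excluded values 0 and -1,
and vicinal chains remain chains.

Induct on `S`: a cograph or its complement falls apart (`NoInducedPath.splits_or_splits_compl`), so
one may assume there are no edges between two parts. An isolated vertex can be deleted without
lowering the dimension, as `μ ≠ 0`. Without isolated vertices, no chain meets both parts, and
dimensions add at most like numbers of chains (`finrank_shiftedEigenspace_le_of_splits`).

For sharpness, a `-s`-eigenvector of the extremal graph is determined by `k` free values, one on
each part. -/

/-! ### Cographs: splitting, the vicinal preorder and complementation. -/

section Cographs

variable {V : Type*} {G : SimpleGraph V}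

/-- A cograph has no four vertices `a, b, c, d` spanning an induced path in this order. -/
def NoInducedPath (G : SimpleGraph V) : Prop :=
  ∀ a b c d, G.Adj a b → G.Adj b c → G.Adj c d → ¬ G.Adj a c → ¬ G.Adj b d → G.Adj a d

theorem isCograph_iff_noInducedPath : IsCograph G ↔ NoInducedPath G := by
  constructor
  · intro h a b c d hab hbc hcd hac hbd
    by_contra had
    have ab := hab.ne
    have bc := hbc.ne
    have cd := hcd.ne
    have ac : a ≠ c := by rintro rfl; exact had hcd
    have bd : b ≠ d := by rintro rfl; exact had hab
    have ad : a ≠ d := by rintro rfl; exact hac hcd.symm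
    refine h ⟨⟨⟨![a, b, c, d], ?_⟩, ?_⟩⟩
    · intro i j hij
      fin_cases i <;> fin_cases j <;> simp_all
    · intro i j
      change G.Adj (![a, b, c, d] i) (![a, b, c, d] j) ↔ _
      fin_cases i <;> fin_cases j <;>
        simp [SimpleGraph.pathGraph_adj, hab, hbc, hcd, hac, hbd, had, hab.symm, hbc.symm,
          hcd.symm, mt G.adj_symm hac, mt G.adj_symm hbd, mt G.adj_symm had]
  · rintro h ⟨e⟩
    have key : ∀ i j, G.Adj (e i) (e j) ↔ (SimpleGraph.pathGraph 4).Adj i j :=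
      fun i j ↦ e.map_adj_iff
    have := h (e 0) (e 1) (e 2) (e 3)
    simp [key, SimpleGraph.pathGraph_adj] at this

/-- The four-vertex path is self-complementary: a path `a b c d` in the complement is the path `b d
a c` in the graph. -/
theorem NoInducedPath.compl (h : NoInducedPath G) : NoInducedPath Gᶜ := by
  intro a b c d hab hbc hcd hac hbd
  obtain rfl | ac := eq_or_ne a c
  · exact hcd
  obtain rfl | bd := eq_or_ne b d
  · exact hab
  have := h b d a c
  simp only [SimpleGraph.compl_adj] at *
  grind [SimpleGraph.adj_comm]

/-- `S` is partitioned into two nonempty parts with no edge of `G` between them. -/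
def Splits (G : SimpleGraph V) (S : Finset V) : Prop :=
  ∃ A ⊆ S, A.Nonempty ∧ (∃ b ∈ S, b ∉ A) ∧ ∀ a ∈ A, ∀ b ∈ S, b ∉ A → ¬ G.Adj a b

open Classical in
/-- If `S` without `v` splits, then a cograph splits on `insert v S`, or all vertices of `S` are
adjacent to `v`. -/
theorem NoInducedPath.splits_insert (h : NoInducedPath G) {S : Finset V} {v : V} (hv : v ∉ S)
    (hS : Splits G S) : Splits G (insert v S) ∨ ∀ w ∈ S, G.Adj v w := by
  -- a part closed under adjacency within `S` gives the claim as soon as it misses some neighbour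
  have key : ∀ A ⊆ S, (∃ b ∈ S, b ∉ A) → (∀ a ∈ A, ∀ b ∈ S, b ∉ A → ¬ G.Adj a b) →
      (∃ w ∈ A, ¬ G.Adj v w) → Splits G (insert v S) := by
    rintro A hAS ⟨b₀, hb₀, hb₀A⟩ hA ⟨w, hwA, hvw⟩
    by_contra hsp
    -- Otherwise the non-neighbours of `v` in `A` are cut off from the rest of `insert v S`.
    have hedge : ∃ a ∈ A, ¬ G.Adj v a ∧ ∃ b ∈ A, G.Adj v b ∧ G.Adj a b := by
      by_contra! hno
      refine hsp ⟨A.filter fun a ↦ ¬ G.Adj v a, ?_, ⟨w, by simp [hwA, hvw]⟩,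
        ⟨v, by simp, by simp [mt (@hAS v) hv]⟩, ?_⟩
      · intro a ha
        simp [hAS (Finset.mem_filter.1 ha).1]
      · intro a ha b hb hbA hab
        simp only [Finset.mem_filter, not_and, not_not] at ha hbA
        rcases Finset.mem_insert.1 hb with rfl | hb
        · exact ha.2 hab.symm
        · by_cases hbA' : b ∈ A
          · exact hno a ha.1 ha.2 b hbA' (hbA hbA') hab
          · exact hA a ha.1 b hb hbA' hab
    -- Otherwise `S \ A` is cut off from `v` as well as from `A`.
    have hout : ∃ d ∈ S, d ∉ A ∧ G.Adj v d := by
      by_contra! hno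
      refine hsp ⟨S \ A, fun a ha ↦ by simp_all, ⟨b₀, by simp [hb₀, hb₀A]⟩,
        ⟨v, by simp, by simp [hv]⟩, ?_⟩
      intro a ha b hb hbA hab
      simp only [Finset.mem_sdiff, not_and, not_not] at ha hbA
      rcases Finset.mem_insert.1 hb with rfl | hb
      · exact hno a ha.1 ha.2 hab.symm
      · exact hA b (hbA hb) a ha.1 ha.2 hab.symm
    obtain ⟨a, haA, hva, b, hbA, hvb, hab⟩ := hedge
    obtain ⟨d, hdS, hdA, hvd⟩ := hout
    -- Here `a b v d` would be an induced path.
    exact hA a haA d hdS hdA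
      (h a b v d hab hvb.symm hvd (fun h ↦ hva h.symm) (hA b hbA d hdS hdA))
  obtain ⟨A, hAS, hne, ⟨b₀, hb₀, hb₀A⟩, hA⟩ := hS
  by_cases hall : ∀ w ∈ S, G.Adj v w
  · exact .inr hall
  push Not at hall
  obtain ⟨w, hwS, hvw⟩ := hall
  left
  by_cases hwA : w ∈ A
  · exact key A hAS ⟨b₀, hb₀, hb₀A⟩ hA ⟨w, hwA, hvw⟩
  · obtain ⟨a₀, ha₀⟩ := hne
    refine key (S \ A) Finset.sdiff_subset ⟨a₀, hAS ha₀, by simp [ha₀]⟩ ?_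
      ⟨w, by simp [hwS, hwA], hvw⟩
    intro a ha b hb hbA hab
    simp only [Finset.mem_sdiff, not_and, not_not] at ha hbA
    exact hA b (hbA hb) a ha.1 ha.2 hab.symm

theorem splits_insert_of_not_adj {S : Finset V} [DecidableEq V] {v : V} (hv : v ∉ S)
    (hS : S.Nonempty) (h : ∀ w ∈ S, ¬ G.Adj v w) : Splits G (insert v S) := by
  obtain ⟨b, hb⟩ := hS
  refine ⟨{v}, by simp, by simp, ⟨b, by simp [hb], by simp; rintro rfl; exact hv hb⟩, ?_⟩
  intro a ha b hb hbA
  simp only [Finset.mem_singleton, Finset.mem_insert] at ha hb hbA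
  subst ha
  exact h b (hb.resolve_left hbA)

/-- A cograph on at least two vertices is disconnected or has a disconnected complement. -/
theorem NoInducedPath.splits_or_splits_compl (h : NoInducedPath G) {S : Finset V}
    (hS : S.Nontrivial) : Splits G S ∨ Splits Gᶜ S := by
  classical
  induction S using Finset.induction_on with
  | empty => simp at hS
  | insert v S hv ih =>
    have hne : S.Nonempty := by
      rw [Finset.nonempty_iff_ne_empty]
      rintro rfl
      simp at hS
    have adj_compl : (∀ w ∈ S, G.Adj v w) → Splits Gᶜ (insert v S) := fun hadj ↦
      splits_insert_of_not_adj hv hne fun w hw hc ↦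
        (SimpleGraph.compl_adj _ _ _).1 hc |>.2 (hadj w hw)
    have compl_adj : (∀ w ∈ S, Gᶜ.Adj v w) → Splits G (insert v S) := fun hadj ↦
      splits_insert_of_not_adj hv hne fun w hw ↦ ((SimpleGraph.compl_adj _ _ _).1 (hadj w hw)).2
    rcases hne.exists_eq_singleton_or_nontrivial with ⟨w, rfl⟩ | hnt
    · by_cases hvw : G.Adj v w
      · exact .inr (adj_compl (by simpa using hvw))
      · exact .inl (splits_insert_of_not_adj hv hne (by simpa using hvw))
    · rcases ih hnt with hsp | hsp
      · exact (h.splits_insert hv hsp).imp_right adj_compl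
      · exact ((h.compl.splits_insert hv hsp).imp_right compl_adj).symm

/-- The vicinal preorder of the subgraph induced on `S`. -/
def VicinalOn (G : SimpleGraph V) (S : Finset V) (u v : V) : Prop :=
  ∀ w ∈ S, G.Adj u w → w = v ∨ G.Adj v w

theorem VicinalOn.compl {S : Finset V} {u v : V} (h : VicinalOn G S u v) :
    VicinalOn Gᶜ S v u := by
  intro w hw hvw
  simp only [SimpleGraph.compl_adj] at *
  by_contra! hne
  rcases h w hw (hne.2 hne.1.symm) with h | h
  · exact hvw.1 h.symm
  · exact hvw.2 h

theorem VicinalOn.mono {S T : Finset V} {u v : V} (hTS : T ⊆ S) (h : VicinalOn G S u v) :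
    VicinalOn G T u v := fun w hw ↦ h w (hTS hw)

/-- The colour classes of `f` are chains of the vicinal preorder on `S`. -/
def IsChainColoring {α : Type*} (G : SimpleGraph V) (S : Finset V) (f : V → α) : Prop :=
  ∀ u ∈ S, ∀ v ∈ S, f u = f v → VicinalOn G S u v ∨ VicinalOn G S v u

theorem IsChainColoring.compl {α : Type*} {S : Finset V} {f : V → α}
    (h : IsChainColoring G S f) : IsChainColoring Gᶜ S f :=
  fun u hu v hv huv ↦ (h u hu v hv huv).symm.imp .compl .compl

theorem IsChainColoring.mono {α : Type*} {S T : Finset V} {f : V → α} (hTS : T ⊆ S)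
    (h : IsChainColoring G S f) : IsChainColoring G T f :=
  fun u hu v hv huv ↦ (h u (hTS hu) v (hTS hv) huv).imp (.mono hTS) (.mono hTS)

open Classical in
/-- Restriction of a vector to `A`, extended by zero. -/
noncomputable def restrictTo (A : Finset V) : (V → ℝ) →ₗ[ℝ] (V → ℝ) where
  toFun x v := if v ∈ A then x v else 0
  map_add' x y := by ext v; by_cases h : v ∈ A <;> simp [h]
  map_smul' a x := by ext v; by_cases h : v ∈ A <;> simp [h]

open Classical in
theorem restrictTo_apply (A : Finset V) (x : V → ℝ) (v : V) :
    restrictTo A x v = if v ∈ A then x v else 0 := rfl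

end Cographs

/-! ### Shifted eigenspaces and the multiplicity bound. -/

section ShiftedEigenspace

variable {V : Type*} [Fintype V] {G : SimpleGraph V}

open Classical in
theorem adjOperator_apply (G : SimpleGraph V) (x : V → ℝ) (v : V) :
    adjOperator G x v = ∑ u, if G.Adj v u then x u else 0 := by
  simp [adjOperator, Matrix.mulVec, dotProduct, SimpleGraph.adjMatrix_apply]

theorem adjOperator_congr {x y : V → ℝ} {v : V} (h : ∀ u, G.Adj v u → x u = y u) :
    adjOperator G x v = adjOperator G y v := by
  classical
  simp only [adjOperator_apply]
  exact Finset.sum_congr rfl fun u _ ↦ by split_ifs with hu <;> simp [h, hu]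

theorem adjOperator_eq_zero {x : V → ℝ} {v : V} (h : ∀ u, G.Adj v u → x u = 0) :
    adjOperator G x v = 0 := by
  rw [adjOperator_congr (y := 0) h, map_zero, Pi.zero_apply]

theorem adjOperator_compl_apply (G : SimpleGraph V) (x : V → ℝ) (v : V) :
    adjOperator Gᶜ x v = ∑ u, x u - x v - adjOperator G x v := by
  classical
  have hv : x v = ∑ u, if u = v then x u else 0 := by simp
  rw [adjOperator_apply, adjOperator_apply, hv, ← Finset.sum_sub_distrib,
    ← Finset.sum_sub_distrib]
  refine Finset.sum_congr rfl fun u _ ↦ ?_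
  by_cases huv : u = v
  · subst huv; simp
  · by_cases ha : G.Adj v u <;> simp [ha, huv, Ne.symm huv]

/-- The vectors supported on `S` that satisfy the eigenvalue equation of `G.induce S` for `μ` up to
a multiple of the all-ones vector. -/
def shiftedEigenspace (G : SimpleGraph V) (S : Finset V) (μ : ℝ) : Submodule ℝ (V → ℝ) where
  carrier := {x | (∀ v ∉ S, x v = 0) ∧ ∃ c, ∀ v ∈ S, adjOperator G x v = μ * x v + c}
  zero_mem' := ⟨by simp, 0, by simp⟩
  add_mem' := by
    rintro x y ⟨hx, c, hc⟩ ⟨hy, d, hd⟩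
    refine ⟨fun v hv ↦ by simp [hx v hv, hy v hv], c + d, fun v hv ↦ ?_⟩
    rw [map_add, Pi.add_apply, Pi.add_apply, hc v hv, hd v hv]
    ring
  smul_mem' := by
    rintro a x ⟨hx, c, hc⟩
    refine ⟨fun v hv ↦ by simp [hx v hv], a * c, fun v hv ↦ ?_⟩
    rw [map_smul, Pi.smul_apply, Pi.smul_apply, hc v hv, smul_eq_mul, smul_eq_mul]
    ring

theorem shiftedEigenspace_le_compl (G : SimpleGraph V) (S : Finset V) (μ : ℝ) :
    shiftedEigenspace G S μ ≤ shiftedEigenspace Gᶜ S (-1 - μ) := by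
  rintro x ⟨hx, c, hc⟩
  refine ⟨hx, ∑ u, x u - c, fun v hv ↦ ?_⟩
  rw [adjOperator_compl_apply, hc v hv]
  ring

theorem restrictTo_mem_shiftedEigenspace {S A : Finset V} {μ : ℝ} {x : V → ℝ} (hAS : A ⊆ S)
    (hA : ∀ a ∈ A, ∀ b ∈ S, b ∉ A → ¬ G.Adj a b) (hx : x ∈ shiftedEigenspace G S μ) :
    restrictTo A x ∈ shiftedEigenspace G A μ := by
  obtain ⟨hx, c, hc⟩ := hx
  refine ⟨fun v hv ↦ by simp [restrictTo_apply, hv], c, fun v hv ↦ ?_⟩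
  rw [adjOperator_congr (y := x), hc v (hAS hv), restrictTo_apply, if_pos hv]
  intro u hvu
  by_cases hu : u ∈ A
  · simp [restrictTo_apply, hu]
  · rw [restrictTo_apply, if_neg hu, hx u]
    exact fun huS ↦ hA v hv u huS hu hvu

open Classical in
theorem finrank_shiftedEigenspace_le_add {S A : Finset V} {μ : ℝ} (hAS : A ⊆ S)
    (hA : ∀ a ∈ A, ∀ b ∈ S, b ∉ A → ¬ G.Adj a b) :
    Module.finrank ℝ (shiftedEigenspace G S μ) ≤
      Module.finrank ℝ (shiftedEigenspace G A μ) +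
        Module.finrank ℝ (shiftedEigenspace G (S \ A) μ) := by
  refine (Submodule.finrank_mono fun x hx ↦ ?_).trans
    (Submodule.finrank_add_le_finrank_add_finrank _ _)
  refine Submodule.mem_sup.2 ⟨_, restrictTo_mem_shiftedEigenspace hAS hA hx, restrictTo (S \ A) x,
    restrictTo_mem_shiftedEigenspace Finset.sdiff_subset ?_ hx, ?_⟩
  · intro a ha b hb hbA hab
    simp only [Finset.mem_sdiff, not_and, not_not] at ha hbA
    exact hA b (hbA hb) a ha.1 ha.2 hab.symm
  · ext v
    have := hx.1 v
    by_cases hvA : v ∈ A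
    · simp [restrictTo_apply, hvA]
    · by_cases hvS : v ∈ S <;> simp_all [restrictTo_apply]

-- Restriction away from `w` is injective: for a kernel vector, the equation at any other vertex
-- forces `c = 0`, and then the one at `w` reads `μ * x w = 0`.
open Classical in
theorem finrank_shiftedEigenspace_le_erase {S : Finset V} {w : V} {μ : ℝ} (hμ : μ ≠ 0)
    (hw : w ∈ S) (hS : (S.erase w).Nonempty) (hiso : ∀ u ∈ S, ¬ G.Adj w u) :
    Module.finrank ℝ (shiftedEigenspace G S μ) ≤
      Module.finrank ℝ (shiftedEigenspace G (S.erase w) μ) := by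
  have hmem : ∀ x ∈ shiftedEigenspace G S μ,
      restrictTo (S.erase w) x ∈ shiftedEigenspace G (S.erase w) μ := fun x hx ↦
    restrictTo_mem_shiftedEigenspace (Finset.erase_subset _ _) (by
      intro a ha b hb hbS hab
      obtain rfl : b = w := by simpa [hb] using hbS
      exact hiso a (Finset.mem_of_mem_erase ha) hab.symm) hx
  refine LinearMap.finrank_le_finrank_of_injective (f := (restrictTo (S.erase w)).restrict hmem) ?_
  rw [← LinearMap.ker_eq_bot, LinearMap.ker_eq_bot']
  rintro ⟨x, hx, c, hc⟩ h0
  have h0 : ∀ v, restrictTo (S.erase w) x v = 0 := fun v ↦ congrFun (congrArg Subtype.val h0) v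
  have hxw : ∀ u, u ≠ w → x u = 0 := by
    intro u hu
    by_cases huS : u ∈ S
    · simpa [restrictTo_apply, hu, huS] using h0 u
    · exact hx u huS
  obtain ⟨a, ha⟩ := hS
  have haw := Finset.ne_of_mem_erase ha
  have haS := Finset.mem_of_mem_erase ha
  have hAa : adjOperator G x a = 0 := adjOperator_eq_zero fun u hau ↦ hxw u <| by
    rintro rfl
    exact hiso a haS hau.symm
  have hAw : adjOperator G x w = 0 := adjOperator_eq_zero fun u hwu ↦ hxw u hwu.ne'
  have hca := hc a haS
  have hcw := hc w hw
  rw [hAa, hxw a haw] at hca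
  rw [hAw] at hcw
  have hc0 : c = 0 := by linarith
  have : x w = 0 := by simpa [hc0, hμ] using hcw
  refine Subtype.ext (funext fun u ↦ ?_)
  by_cases hu : u = w
  · rw [hu]; exact this
  · exact hxw u hu

open Classical in
theorem finrank_shiftedEigenspace_singleton_le (G : SimpleGraph V) (w : V) (μ : ℝ) :
    Module.finrank ℝ (shiftedEigenspace G {w} μ) ≤ 1 := by
  refine (Submodule.finrank_mono (t := ℝ ∙ (Pi.single w 1 : V → ℝ)) fun x hx ↦ ?_).trans
    ((finrank_span_le_card _).trans (by simp))
  refine Submodule.mem_span_singleton.2 ⟨x w, ?_⟩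
  ext v
  by_cases hv : v = w
  · subst hv; simp
  · simp [hv, hx.1 v (by simpa using hv)]

open Classical in
theorem finrank_shiftedEigenspace_le_of_splits {α : Type*} {S : Finset V} {f : V → α} {μ : ℝ}
    (hμ : μ ≠ 0) (hf : IsChainColoring G S f) (hsp : Splits G S)
    (ih : ∀ T ⊂ S, Module.finrank ℝ (shiftedEigenspace G T μ) ≤ (T.image f).card) :
    Module.finrank ℝ (shiftedEigenspace G S μ) ≤ (S.image f).card := by
  obtain ⟨A, hAS, ⟨a₀, ha₀⟩, ⟨b₀, hb₀, hb₀A⟩, hA⟩ := hsp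
  by_cases hiso : ∃ w ∈ S, ∀ u ∈ S, ¬ G.Adj w u
  · obtain ⟨w, hw, hiso⟩ := hiso
    have hne : (S.erase w).Nonempty := by
      by_cases h : a₀ = w
      · exact ⟨b₀, Finset.mem_erase.2 ⟨by rintro rfl; exact hb₀A (h ▸ ha₀), hb₀⟩⟩
      · exact ⟨a₀, Finset.mem_erase.2 ⟨h, hAS ha₀⟩⟩
    exact (finrank_shiftedEigenspace_le_erase hμ hw hne hiso).trans <|
      (ih _ (Finset.erase_ssubset hw)).trans <|
        Finset.card_le_card (Finset.image_subset_image (Finset.erase_subset _ _))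
  push Not at hiso
  -- If `a` and `b` in different parts were comparable, a neighbour of the smaller one would have to
  -- be equal or adjacent to the larger one, across the split.
  have hdisj : Disjoint (A.image f) ((S \ A).image f) := by
    rw [Finset.disjoint_left]
    intro i hi hi'
    obtain ⟨a, ha, rfl⟩ := Finset.mem_image.1 hi
    obtain ⟨b, hb, hba⟩ := Finset.mem_image.1 hi'
    obtain ⟨hbS, hbA⟩ := Finset.mem_sdiff.1 hb
    rcases hf a (hAS ha) b hbS hba.symm with h | h
    · obtain ⟨u, hu, hau⟩ := hiso a (hAS ha)
      have huA : u ∈ A := by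
        by_contra huA
        exact hA a ha u hu huA hau
      rcases h u hu hau with rfl | hbu
      · exact hbA huA
      · exact hA u huA b hbS hbA hbu.symm
    · obtain ⟨u, hu, hbu⟩ := hiso b hbS
      have huA : u ∉ A := fun huA ↦ hA u huA b hbS hbA hbu.symm
      rcases h u hu hbu with rfl | hau
      · exact huA ha
      · exact hA a ha u hu huA hau
  have himg : A.image f ∪ (S \ A).image f = S.image f := by
    rw [← Finset.image_union, Finset.union_sdiff_of_subset hAS]
  rw [← himg, Finset.card_union_of_disjoint hdisj]
  refine (finrank_shiftedEigenspace_le_add hAS hA).trans (add_le_add (ih _ ?_) (ih _ ?_))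
  · exact Finset.ssubset_iff_subset_ne.2 ⟨hAS, by rintro rfl; exact hb₀A hb₀⟩
  · exact Finset.sdiff_ssubset hAS ⟨a₀, ha₀⟩

open Classical in
/-- In a cograph, the dimension of a shifted eigenspace is at most the number of chains of the
vicinal preorder needed to cover the graph. -/
theorem NoInducedPath.finrank_shiftedEigenspace_le {α : Type*} (hG : NoInducedPath G)
    {S : Finset V} {f : V → α} {μ : ℝ} (h0 : μ ≠ 0) (h1 : μ ≠ -1) (hf : IsChainColoring G S f) :
    Module.finrank ℝ (shiftedEigenspace G S μ) ≤ (S.image f).card := by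
  -- The complement case changes both the graph and the eigenvalue.
  induction S using Finset.strongInduction generalizing G μ with
  | H S ih =>
    rcases S.eq_empty_or_nonempty with rfl | hne
    · have : shiftedEigenspace G ∅ μ = ⊥ :=
        (Submodule.eq_bot_iff _).2 fun x hx ↦ funext fun v ↦ hx.1 v (by simp)
      simp [this]
    rcases hne.exists_eq_singleton_or_nontrivial with ⟨w, rfl⟩ | hnt
    · simpa using finrank_shiftedEigenspace_singleton_le G w μ
    rcases hG.splits_or_splits_compl hnt with hsp | hsp
    · exact finrank_shiftedEigenspace_le_of_splits h0 hf hsp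
        fun T hT ↦ ih T hT hG h0 h1 (hf.mono hT.subset)
    · have h0' : -1 - μ ≠ 0 := fun h ↦ h1 (by linarith)
      have h1' : -1 - μ ≠ -1 := fun h ↦ h0 (by linarith)
      exact (Submodule.finrank_mono (shiftedEigenspace_le_compl G S μ)).trans <|
        finrank_shiftedEigenspace_le_of_splits h0' hf.compl hsp
          fun T hT ↦ ih T hT hG.compl h0' h1' (hf.compl.mono hT.subset)

/-- The Dilworth number is attained by a colouring with chains as colour classes. -/
theorem exists_chain_coloring (G : SimpleGraph V) :
    ∃ f : V → Fin (dilworthNumber G), ∀ u v, f u = f v → Vicinal G u v ∨ Vicinal G v u := by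
  -- Singletons give a cover, so `sInf` is attained and is not the default value 0 of an empty set.
  have hne : {n : ℕ | ∃ C : Fin n → Set V,
      (∀ i, IsChain (Vicinal G) (C i)) ∧ ⋃ i, C i = Set.univ}.Nonempty :=
    ⟨Fintype.card V, fun i ↦ {(Fintype.equivFin V).symm i}, fun i ↦ by simp [IsChain],
      Set.eq_univ_of_forall fun v ↦ Set.mem_iUnion.2 ⟨Fintype.equivFin V v, by simp⟩⟩
  obtain ⟨C, hC, hcov⟩ := Nat.sInf_mem hne
  have hmem : ∀ v, ∃ i, v ∈ C i := fun v ↦ Set.mem_iUnion.1 (hcov.symm ▸ Set.mem_univ v)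
  choose f hf using hmem
  refine ⟨f, fun u v huv ↦ ?_⟩
  rcases eq_or_ne u v with rfl | hne
  · exact .inl fun w hw ↦ Set.mem_insert_of_mem _ hw
  · exact hC (f u) (hf u) (huv ▸ hf v) hne

theorem dilworthNumber_le {n : ℕ} (f : V → Fin n)
    (hf : ∀ u v, f u = f v → Vicinal G u v ∨ Vicinal G v u) : dilworthNumber G ≤ n :=
  Nat.sInf_le ⟨fun i ↦ f ⁻¹' {i},
    fun _ u hu v hv _ ↦ hf u v (hu.trans hv.symm), Set.eq_univ_of_forall fun v ↦ by simp⟩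

/-- The multiplicity of an eigenvalue of a cograph other than `0` and `-1` is at most the Dilworth
number. -/
theorem IsCograph.eigMult_le_dilworthNumber (hG : IsCograph G) {μ : ℝ} (h0 : μ ≠ 0)
    (h1 : μ ≠ -1) : eigMult G μ ≤ dilworthNumber G := by
  classical
  obtain ⟨f, hf⟩ := exists_chain_coloring G
  have hle : Module.End.eigenspace (adjOperator G) μ ≤ shiftedEigenspace G Finset.univ μ := by
    intro x hx
    refine ⟨by simp, 0, fun v _ ↦ ?_⟩
    rw [Module.End.mem_eigenspace_iff.1 hx]
    simp
  refine (Submodule.finrank_mono hle).trans <|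
    ((isCograph_iff_noInducedPath.1 hG).finrank_shiftedEigenspace_le h0 h1 (f := f) ?_).trans
      ((Finset.card_le_univ _).trans (by simp))
  exact fun u _ v _ huv ↦ (hf u v huv).imp (fun h w _ hw ↦ h hw) (fun h w _ hw ↦ h hw)

end ShiftedEigenspace

/-! ### The extremal family. -/

section Extremal

theorem SimpleGraph.Iso.dilworthNumber_le {V W : Type*} [Fintype V] [Fintype W]
    {G : SimpleGraph V} {H : SimpleGraph W} (e : G ≃g H) :
    dilworthNumber G ≤ dilworthNumber H := by
  obtain ⟨f, hf⟩ := exists_chain_coloring H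
  have key : ∀ u v, Vicinal H (e u) (e v) → Vicinal G u v := by
    intro u v h w hw
    have := h (show H.Adj (e u) (e w) from e.map_adj_iff.2 hw)
    rcases this with h | h
    · exact .inl (e.injective h)
    · exact .inr (e.map_adj_iff.1 h)
  exact _root_.dilworthNumber_le (f ∘ e) fun u v huv ↦ (hf _ _ huv).imp (key u v) (key v u)

theorem SimpleGraph.Iso.dilworthNumber_eq {V W : Type*} [Fintype V] [Fintype W]
    {G : SimpleGraph V} {H : SimpleGraph W} (e : G ≃g H) :
    dilworthNumber G = dilworthNumber H :=
  e.dilworthNumber_le.antisymm e.symm.dilworthNumber_le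

variable {s k : ℕ}

@[simp] theorem extremalCograph_adj_apex_apex (a b : Fin 1) :
    ¬ (extremalCograph s k).Adj (.inl a) (.inl b) := by
  simp [extremalCograph, graphJoin]

@[simp] theorem extremalCograph_adj_apex_inr (a : Fin 1) (x : (Fin k × Fin s) ⊕ Fin (s ^ 2 - s)) :
    (extremalCograph s k).Adj (.inl a) (.inr x) := by
  simp [extremalCograph, graphJoin]

@[simp] theorem extremalCograph_adj_inr_apex (a : Fin 1) (x : (Fin k × Fin s) ⊕ Fin (s ^ 2 - s)) :
    (extremalCograph s k).Adj (.inr x) (.inl a) := by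
  simp [extremalCograph, graphJoin]

@[simp] theorem extremalCograph_adj_part_part (p q : Fin k × Fin s) :
    (extremalCograph s k).Adj (.inr (.inl p)) (.inr (.inl q)) ↔ p.1 ≠ q.1 := by
  simp [extremalCograph, graphJoin]

@[simp] theorem extremalCograph_adj_part_pendant (p : Fin k × Fin s) (t : Fin (s ^ 2 - s)) :
    ¬ (extremalCograph s k).Adj (.inr (.inl p)) (.inr (.inr t)) := by
  simp [extremalCograph, graphJoin]

@[simp] theorem extremalCograph_adj_pendant_part (p : Fin k × Fin s) (t : Fin (s ^ 2 - s)) :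
    ¬ (extremalCograph s k).Adj (.inr (.inr t)) (.inr (.inl p)) := by
  simp [extremalCograph, graphJoin]

@[simp] theorem extremalCograph_adj_pendant_pendant (t u : Fin (s ^ 2 - s)) :
    ¬ (extremalCograph s k).Adj (.inr (.inr t)) (.inr (.inr u)) := by
  simp [extremalCograph, graphJoin]

theorem isCograph_extremalCograph (s k : ℕ) : IsCograph (extremalCograph s k) := by
  rw [isCograph_iff_noInducedPath]
  rintro (a | a | a) (b | b | b) (c | c | c) (d | d | d) <;> simp +contextual

theorem connected_extremalCograph (s k : ℕ) : (extremalCograph s k).Connected := by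
  have : Nonempty (Fin 1 ⊕ ((Fin k × Fin s) ⊕ Fin (s ^ 2 - s))) := ⟨.inl 0⟩
  have hr : ∀ v, (extremalCograph s k).Reachable (.inl 0) v := by
    rintro (a | x)
    · rw [Subsingleton.elim a 0]
    · exact SimpleGraph.Adj.reachable (by simp)
  exact ⟨fun u v ↦ (hr u).symm.trans (hr v)⟩

theorem adjOperator_extremalCograph_apex
    (x : Fin 1 ⊕ ((Fin k × Fin s) ⊕ Fin (s ^ 2 - s)) → ℝ) (a : Fin 1) :
    adjOperator (extremalCograph s k) x (.inl a) =
      ∑ i, ∑ j, x (.inr (.inl (i, j))) + ∑ t, x (.inr (.inr t)) := by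
  simp [adjOperator_apply, Fintype.sum_sum_type, Fintype.sum_prod_type]

theorem adjOperator_extremalCograph_part
    (x : Fin 1 ⊕ ((Fin k × Fin s) ⊕ Fin (s ^ 2 - s)) → ℝ) (p : Fin k × Fin s) :
    adjOperator (extremalCograph s k) x (.inr (.inl p)) =
      x (.inl 0) + (∑ i, ∑ j, x (.inr (.inl (i, j))) - ∑ j, x (.inr (.inl (p.1, j)))) := by
  have : ∑ j, x (.inr (.inl (p.1, j))) =
      ∑ i, if p.1 = i then ∑ j, x (.inr (.inl (i, j))) else 0 := by simp
  rw [this, ← Finset.sum_sub_distrib]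
  simp only [adjOperator_apply, Fintype.sum_sum_type, Fintype.sum_prod_type]
  simp only [extremalCograph_adj_inr_apex, extremalCograph_adj_part_part,
    extremalCograph_adj_part_pendant, if_true, if_false, Finset.univ_unique, Finset.sum_singleton,
    Finset.sum_const_zero, add_zero, Fin.default_eq_zero]
  congr 1
  refine Finset.sum_congr rfl fun i _ ↦ ?_
  by_cases h : p.1 = i <;> simp [h]

theorem adjOperator_extremalCograph_pendant
    (x : Fin 1 ⊕ ((Fin k × Fin s) ⊕ Fin (s ^ 2 - s)) → ℝ) (t : Fin (s ^ 2 - s)) :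
    adjOperator (extremalCograph s k) x (.inr (.inr t)) = x (.inl 0) := by
  simp [adjOperator_apply, Fintype.sum_sum_type]

/-- The vector on `extremalCograph s k` with value `y i` on the `i`-th part, extended to the other
vertices as the eigenvalue equation for `-s` demands. -/
def extremalVector (s k : ℕ) :
    (Fin k → ℝ) →ₗ[ℝ] (Fin 1 ⊕ ((Fin k × Fin s) ⊕ Fin (s ^ 2 - s)) → ℝ) where
  toFun y := Sum.elim (fun _ ↦ -(s * ∑ i, y i)) (Sum.elim (fun p ↦ y p.1) (fun _ ↦ ∑ i, y i))
  map_add' y z := by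
    ext (a | p | t) <;> simp [Finset.sum_add_distrib]; ring
  map_smul' c y := by
    ext (a | p | t) <;> simp [Finset.mul_sum, mul_left_comm]

/-- On a part the apex value cancels the total over all parts, leaving `-s * y i`. At the apex,
parts and pendants contribute `s + (s ^ 2 - s) = s ^ 2` times `∑ i, y i`, which fixes the number of
pendants. -/
theorem extremalVector_mem_eigenspace (s k : ℕ) (y : Fin k → ℝ) :
    extremalVector s k y ∈
      Module.End.eigenspace (adjOperator (extremalCograph s k)) (-(s : ℝ)) := by
  rw [Module.End.mem_eigenspace_iff]
  have hs : s ≤ s ^ 2 := Nat.le_self_pow two_ne_zero s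
  ext (a | p | t)
  · rw [adjOperator_extremalCograph_apex]
    simp [extremalVector, Nat.cast_sub hs, ← Finset.mul_sum]
    ring
  · rw [adjOperator_extremalCograph_part]
    simp [extremalVector, ← Finset.mul_sum]
    ring
  · rw [adjOperator_extremalCograph_pendant]
    simp [extremalVector]

theorem eq_extremalVector_of_mem_eigenspace (hs : 1 ≤ s)
    {x : Fin 1 ⊕ ((Fin k × Fin s) ⊕ Fin (s ^ 2 - s)) → ℝ}
    (hx : x ∈ Module.End.eigenspace (adjOperator (extremalCograph s k)) (-(s : ℝ))) :
    x = extremalVector s k fun i ↦ x (.inr (.inl (i, ⟨0, hs⟩))) := by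
  have hs0 : (s : ℝ) ≠ 0 := by positivity
  have hle : s ≤ s ^ 2 := Nat.le_self_pow two_ne_zero s
  rw [Module.End.mem_eigenspace_iff] at hx
  have hapex := congrFun hx (.inl 0)
  have hpart := fun p ↦ congrFun hx (.inr (.inl p))
  have hpend := fun t ↦ congrFun hx (.inr (.inr t))
  simp only [adjOperator_extremalCograph_apex, adjOperator_extremalCograph_part,
    adjOperator_extremalCograph_pendant, Pi.smul_apply, smul_eq_mul] at hapex hpart hpend
  set y : Fin k → ℝ := fun i ↦ x (.inr (.inl (i, ⟨0, hs⟩))) with hy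
  -- The neighbour sum is the same at all vertices of a part, so the value is too.
  have hconst : ∀ p : Fin k × Fin s, x (.inr (.inl p)) = y p.1 := by
    intro p
    have h1 := hpart p
    have h2 := hpart (p.1, ⟨0, hs⟩)
    exact mul_left_cancel₀ (neg_ne_zero.2 hs0) (h1.symm.trans h2)
  simp only [hconst, Finset.sum_const, Finset.card_univ, Fintype.card_fin, nsmul_eq_mul,
    ← Finset.mul_sum] at hapex hpart
  have hpend' : ∀ t, x (.inr (.inr t)) = -x (.inl 0) / s := by
    intro t
    rw [hpend t]
    field_simp
  simp only [hpend', Finset.sum_const, Finset.card_univ, Fintype.card_fin, nsmul_eq_mul,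
    Nat.cast_sub hle, Nat.cast_pow] at hapex
  have hx0 : x (.inl 0) = -(s * ∑ i, y i) := by
    field_simp at hapex
    linarith
  ext (a | p | t)
  · rw [Subsingleton.elim a 0, hx0]
    rfl
  · exact hconst p
  · rw [hpend', hx0]
    simp [extremalVector]
    field_simp

theorem eigMult_extremalCograph (hs : 1 ≤ s) (k : ℕ) :
    eigMult (extremalCograph s k) (-(s : ℝ)) = k := by
  have hrange : Module.End.eigenspace (adjOperator (extremalCograph s k)) (-(s : ℝ)) =
      LinearMap.range (extremalVector s k) := by
    refine le_antisymm (fun x hx ↦ ⟨_, (eq_extremalVector_of_mem_eigenspace hs hx).symm⟩) ?_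
    rintro _ ⟨y, rfl⟩
    exact extremalVector_mem_eigenspace s k y
  rw [eigMult, hrange, LinearMap.finrank_range_of_inj, Module.finrank_fin_fun]
  intro y z h
  ext i
  exact congrFun h (.inr (.inl (i, ⟨0, hs⟩)))

theorem hasEigenvalue_extremalCograph (hs : 1 ≤ s) (hk : 1 ≤ k) :
    (adjOperator (extremalCograph s k)).HasEigenvalue (-(s : ℝ)) := by
  rw [Module.End.hasEigenvalue_iff]
  intro h
  have := eigMult_extremalCograph hs k
  rw [eigMult, h, finrank_bot] at this
  omega

theorem dilworthNumber_extremalCograph (hs : 2 ≤ s) (hk : 1 ≤ k) :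
    dilworthNumber (extremalCograph s k) = k := by
  apply le_antisymm
  · refine dilworthNumber_le (Sum.elim (fun _ ↦ ⟨0, hk⟩) (Sum.elim Prod.fst fun _ ↦ ⟨0, hk⟩)) ?_
    have hapex : ∀ u a, Vicinal (extremalCograph s k) u (.inl a) := by
      rintro u a (b | w) _
      · exact .inl (congrArg _ (Subsingleton.elim _ _))
      · exact .inr (extremalCograph_adj_apex_inr a w)
    have hpend : ∀ t x, Vicinal (extremalCograph s k) (.inr (.inr t)) (.inr x) := by
      rintro t x (b | b | b) h <;> simp_all [SimpleGraph.mem_neighborSet]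
    rintro (a | p | t) (b | q | u) h
    · exact .inl (hapex _ _)
    · exact .inr (hapex _ _)
    · exact .inr (hapex _ _)
    · exact .inl (hapex _ _)
    · left
      rintro (c | r | v) hr <;> simp_all [SimpleGraph.mem_neighborSet]
    · exact .inr (hpend _ _)
    · exact .inl (hapex _ _)
    · exact .inl (hpend _ _)
    · exact .inl (hpend _ _)
  · obtain ⟨f, hf⟩ := exists_chain_coloring (extremalCograph s k)
    have key : ∀ i j : Fin k, i ≠ j → ¬ Vicinal (extremalCograph s k)
        (.inr (.inl (i, ⟨0, by omega⟩))) (.inr (.inl (j, ⟨0, by omega⟩))) := by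
      intro i j hij h
      -- A second vertex of part `j`, available since `s ≥ 2`, is adjacent to part `i` but is
      -- neither the first vertex of part `j` nor adjacent to it.
      have := h (show (extremalCograph s k).Adj _ (.inr (.inl (j, ⟨1, by omega⟩))) by simp [hij])
      simp [SimpleGraph.mem_neighborSet] at this
    have hinj : Function.Injective fun i : Fin k ↦ f (.inr (.inl (i, ⟨0, by omega⟩))) := by
      intro i j hij
      by_contra hne
      rcases hf _ _ hij with h | h
      · exact key i j hne h
      · exact key j i (Ne.symm hne) h
    simpa using Fintype.card_le_of_injective _ hinj

/-- The Dilworth number recovers `k`; the order `s ^ 2 + (k - 1) * s + 1` is then strictly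
increasing in `s`. -/
theorem eq_of_extremalCograph_iso {s' k' : ℕ} (hs : 2 ≤ s) (hk : 1 ≤ k) (hs' : 2 ≤ s')
    (hk' : 1 ≤ k') (e : extremalCograph s k ≃g extremalCograph s' k') : s = s' ∧ k = k' := by
  obtain rfl : k = k' := by
    rw [← dilworthNumber_extremalCograph hs hk, e.dilworthNumber_eq,
      dilworthNumber_extremalCograph hs' hk']
  refine ⟨?_, rfl⟩
  have hcard := Fintype.card_congr e.toEquiv
  simp only [Fintype.card_sum, Fintype.card_prod, Fintype.card_fin] at hcard
  have hle : s ≤ s ^ 2 := Nat.le_self_pow two_ne_zero s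
  have hle' : s' ≤ s' ^ 2 := Nat.le_self_pow two_ne_zero s'
  zify [hle, hle'] at hcard
  rcases lt_trichotomy s s' with h | h | h
  · zify at h hk hs; nlinarith
  · exact h
  · zify at h hk hs'; nlinarith

end Extremal

theorem mainTheorem1 :
    (∀ {V : Type*} [Fintype V] (G : SimpleGraph V) (μ : ℝ), IsCograph G →
      (adjOperator G).HasEigenvalue μ → μ ≠ 0 → μ ≠ -1 →
        eigMult G μ ≤ dilworthNumber G) ∧
    (∀ s k : ℕ, 1 ≤ s → 1 ≤ k →
      IsCograph (extremalCograph s k) ∧ (extremalCograph s k).Connected ∧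
        (adjOperator (extremalCograph s k)).HasEigenvalue (-(s : ℝ)) ∧
        eigMult (extremalCograph s k) (-(s : ℝ)) = k) ∧
    (∀ s k : ℕ, 2 ≤ s → 1 ≤ k → dilworthNumber (extremalCograph s k) = k) ∧
    (∀ s k s' k' : ℕ, 2 ≤ s → 1 ≤ k → 2 ≤ s' → 1 ≤ k' →
      Nonempty (extremalCograph s k ≃g extremalCograph s' k') → s = s' ∧ k = k') := by
  refine ⟨fun G μ hG _ h0 h1 ↦ hG.eigMult_le_dilworthNumber h0 h1, fun s k hs hk ↦ ?_,
    fun s k hs hk ↦ dilworthNumber_extremalCograph hs hk,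
    fun s k s' k' hs hk hs' hk' ⟨e⟩ ↦ eq_of_extremalCograph_iso hs hk hs' hk' e⟩
  exact ⟨isCograph_extremalCograph s k, connected_extremalCograph s k,
    hasEigenvalue_extremalCograph hs hk, eigMult_extremalCograph hs k⟩
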